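/- Let $\mathfrak G$ be the Grigorchuk group, i.e. the group of automorphisms of the binary rooted tree (with vertex set the finite words over $\{0,1\}$) generated by $a,b,c,d$, where $a$ fixes the empty word and satisfies $a(0w)=1w$, $a(1w)=0w$, and where $b,c,d$ fix the empty word and are defined recursively by $$b(0w)=0\,a(w),\quad b(1w)=1\,c(w),\quad c(0w)=0\,a(w),\quad c(1w)=1\,d(w),\quad d(0w)=0w,\quad d(1w)=1\,b(w)$$ for every finite word $w$. A group $E$ is of type $\mathrm{FP}_2$ if the trivial $\mathbf Z[E]$-module $\mathbf Z$ has a resolution $\cdots\to P_2\to P_1\to P_0\to\mathbf Z\to 0$ by projective $\mathbf Z[E]$-modules with $P_0,P_1,P_2$ finitely generated. A group is large if it has a subgroup of finite index that surjects onto a non-abelian free group. Any cover of type $\mathrm{FP}_2$ of $\mathfrak G$ is large: if $E$ is a group of type $\mathrm{FP}_2$ and there is an epimorphism $E\twoheadrightarrow\mathfrak G$, then $E$ is large. -/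

import Mathlib

universe u

/-- Names of the four standard generators of the Grigorchuk group. -/
inductive GrigGen : Type
  | a
  | b
  | c
  | d

/-- The action of the generators on the vertices of the binary rooted tree, that is, on finite
words over `{0, 1}`, where `false` stands for `0` and `true` for `1`. It encodes the wreath
recursion `a = (1, 1)τ`, `b = (a, c)`, `c = (a, d)`, `d = (1, b)`: a generator `s = (s₀, s₁)` sends
`0w` to `0 s₀(w)` and `1w` to `1 s₁(w)`, and `a` exchanges `0w` and `1w`. -/
def grigAct : GrigGen → List Bool → List Bool
  | _, [] => []
  | .a, x :: w => (!x) :: w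
  | .b, false :: w => false :: grigAct .a w
  | .b, true :: w => true :: grigAct .c w
  | .c, false :: w => false :: grigAct .a w
  | .c, true :: w => true :: grigAct .d w
  | .d, false :: w => false :: w
  | .d, true :: w => true :: grigAct .b w

theorem grigAct_involutive (s : GrigGen) : Function.Involutive (grigAct s) := by
  intro w
  induction w generalizing s with
  | nil => cases s <;> simp [grigAct]
  | cons x w ih => cases s <;> cases x <;> simp [grigAct, ih]

/-- The generators as permutations of the vertex set of the binary rooted tree. -/
def grigPerm (s : GrigGen) : Equiv.Perm (List Bool) :=
  (grigAct_involutive s).toPerm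

/-- The Grigorchuk group: the group of automorphisms of the binary rooted tree generated by
`a, b, c, d` (an automorphism of the tree is given by its action on the vertices). -/
def GrigorchukGroup : Subgroup (Equiv.Perm (List Bool)) :=
  Subgroup.closure (Set.range grigPerm)

/-- A group `G` is of type `FP_n` if the trivial `ℤ[G]`-module `ℤ` has a resolution
`⋯ ⟶ P₂ ⟶ P₁ ⟶ P₀ ⟶ ℤ ⟶ 0` by projective `ℤ[G]`-modules `P j` such that `P j` is finitely generated
for all `j ≤ n`. -/
def IsTypeFP (n : ℕ) (G : Type u) [Group G] : Prop :=
  ∃ (P : ℕ → Type u) (_ : ∀ j, AddCommGroup (P j)) (_ : ∀ j, Module (MonoidAlgebra ℤ G) (P j))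
    (ε : P 0 →ₗ[MonoidAlgebra ℤ G] (Representation.trivial ℤ G ℤ).asModule)
    (δ : ∀ j, P (j + 1) →ₗ[MonoidAlgebra ℤ G] P j),
    (∀ j, Module.Projective (MonoidAlgebra ℤ G) (P j)) ∧
    (∀ j, j ≤ n → Module.Finite (MonoidAlgebra ℤ G) (P j)) ∧
    Function.Surjective ε ∧
    Function.Exact (δ 0) ε ∧
    ∀ j, Function.Exact (δ (j + 1)) (δ j)

/-- A group is large if it has a subgroup of finite index with a non-abelian free quotient,
that is, with an epimorphism onto a free group on a set of at least two elements. -/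
def IsLargeGroup (G : Type u) [Group G] : Prop :=
  ∃ H : Subgroup G, H.FiniteIndex ∧
    ∃ (X : Type) (_ : Nontrivial X) (f : H →* FreeGroup X), Function.Surjective f

/-!
# Covers of type `FP₂` of the Grigorchuk group are large

The Grigorchuk group is a limit of the quotients of `Γ = C₂ * V₄` (`GrigCover`) by the subgroups
`Kₙ` of the elements which fix the `n`-th level of the tree and have trivial sections there. Indeed,
the wreath recursion makes sense in `Γ` (`GrigCover.treePerm`), and it is contracting, so that every
element of `Γ` which acts trivially on the tree lies in some `Kₙ`
(`GrigCover.exists_forall_sect_eq_one`). If a quotient `F → E` of a free group is a cover of the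
Grigorchuk group, lift `F → E → 𝔊` to a surjection `F → Γ`. If `E` is finitely presented, then
finitely many relators are killed at a common level `n`, so `E` maps onto `Γ / Kₙ`; the section at
`1ⁿ` maps the stabilizer of `1ⁿ`, a subgroup of finite index of `E`, onto `Γ`
(`GrigCover.exists_sect_replicate_eq`), and `Γ` is large.

If `E` is only of type `FP₂`, its relation module is finitely generated: the kernel `N` of `F → E` is
the product of the normal closure of finitely many relators and of `[N, N]`. The sections of `N` at
a vertex of level `n` thus form a perfect subgroup of `Γ`, and `Γ` has no perfect subgroup except the
trivial one (`GrigCover.eq_bot_of_le_commutator`), because it embeds in a semidirect product of a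
free group by an abelian group. So `N` still dies in `Γ / Kₙ`, and the argument goes through.

To obtain the relators, a form of Schanuel's lemma shows that the augmentation ideal of `Z[E]` is
finitely presented as soon as `E` is of type `FP₂`. Hence `E` is finitely generated, say by `S`, and
the kernel of `Z[E]^S → Z[E]`, `e_s ↦ s - 1`, is finitely generated; Fox calculus identifies this
kernel with the relation module (`GroupRing.mem_commutator_of_fox_eq_zero`,
`GroupRing.exists_fox_eq`).
-/

/-! ### The free product which covers the Grigorchuk group -/

/-- The relators `s²`, for `s` a generator, and `bcd`. -/
def grigCoverRels : Set (FreeGroup GrigGen) :=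
  {r | (∃ s, r = FreeGroup.of s * FreeGroup.of s) ∨
    r = FreeGroup.of .b * FreeGroup.of .c * FreeGroup.of .d}

/-- The group `⟨a, b, c, d | a² = b² = c² = d² = bcd = 1⟩`, that is, the free product of a group of
order two and a Klein four-group, which covers the Grigorchuk group. -/
abbrev GrigCover : Type := PresentedGroup grigCoverRels

namespace GrigCover

open GrigGen

/-- The generators of `GrigCover`. -/
abbrev gen (s : GrigGen) : GrigCover := PresentedGroup.of s

@[simp]
theorem gen_mul_self (s : GrigGen) : gen s * gen s = 1 :=
  PresentedGroup.one_of_mem (rels := grigCoverRels) (x := FreeGroup.of s * FreeGroup.of s)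
    (Or.inl ⟨s, rfl⟩)

@[simp]
theorem gen_mul_gen_cancel_left (s : GrigGen) (g : GrigCover) : gen s * (gen s * g) = g := by
  rw [← mul_assoc, gen_mul_self, one_mul]

theorem gen_b_c_d : gen b * gen c * gen d = 1 :=
  PresentedGroup.one_of_mem (rels := grigCoverRels)
    (x := FreeGroup.of b * FreeGroup.of c * FreeGroup.of d) (Or.inr rfl)

@[simp]
theorem gen_inv (s : GrigGen) : (gen s)⁻¹ = gen s :=
  inv_eq_of_mul_eq_one_left (gen_mul_self s)

section lift

variable {G : Type*} [Group G]

/-- The universal property of `GrigCover`. -/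
def lift (f : GrigGen → G) (h₂ : ∀ s, f s * f s = 1) (h₃ : f b * f c * f d = 1) :
    GrigCover →* G :=
  PresentedGroup.toGroup (f := f) (by
    rintro r (⟨s, rfl⟩ | rfl)
    · simpa using h₂ s
    · simpa using h₃)

@[simp]
theorem lift_gen (f : GrigGen → G) (h₂ : ∀ s, f s * f s = 1) (h₃ : f b * f c * f d = 1)
    (s : GrigGen) : lift f h₂ h₃ (gen s) = f s :=
  PresentedGroup.toGroup.of _

end lift

theorem closure_gen : Subgroup.closure (Set.range gen) = ⊤ :=
  PresentedGroup.closure_range_of _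

/-- As the generators are involutions, they generate `GrigCover` as a monoid. -/
theorem induction_gen {C : GrigCover → Prop} (one : C 1)
    (mul_gen : ∀ g s, C g → C (g * gen s)) (g : GrigCover) : C g := by
  have hg : g ∈ Subgroup.closure (Set.range gen) := by rw [closure_gen]; trivial
  induction hg using Subgroup.closure_induction_right with
  | one => exact one
  | mul_right x hx y hy ih => obtain ⟨s, rfl⟩ := hy; exact mul_gen _ _ ih
  | mul_inv_cancel x hx y hy ih =>
    obtain ⟨s, rfl⟩ := hy
    rw [gen_inv]
    exact mul_gen _ _ ih

/-! ### The action on the tree and sections -/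

theorem grigAct_b_c_d (w : List Bool) : grigAct b (grigAct c (grigAct d w)) = w := by
  suffices h : ∀ w, grigAct b (grigAct c (grigAct d w)) = w ∧
      grigAct c (grigAct d (grigAct b w)) = w ∧ grigAct d (grigAct b (grigAct c w)) = w from
    (h w).1
  intro w
  induction w with
  | nil => simp [grigAct]
  | cons x w ih =>
    have ha := grigAct_involutive a w
    cases x <;> simp [grigAct, ih, ha]

theorem length_grigAct (s : GrigGen) (w : List Bool) : (grigAct s w).length = w.length := by
  induction w generalizing s with
  | nil => cases s <;> simp [grigAct]
  | cons x w ih => cases s <;> cases x <;> simp [grigAct, ih]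

/-- The action of `GrigCover` on the binary rooted tree. -/
def toPerm : GrigCover →* Equiv.Perm (List Bool) :=
  lift grigPerm (fun s => Equiv.ext (grigAct_involutive s)) (Equiv.ext grigAct_b_c_d)

@[simp]
theorem toPerm_gen (s : GrigGen) (w : List Bool) : toPerm (gen s) w = grigAct s w := by
  simp [toPerm, grigPerm]

theorem range_toPerm : toPerm.range = GrigorchukGroup := by
  rw [MonoidHom.range_eq_map, ← closure_gen, MonoidHom.map_closure, GrigorchukGroup,
    ← Set.range_comp]
  congr 2

theorem length_toPerm (g : GrigCover) (w : List Bool) : (toPerm g w).length = w.length := by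
  induction g using induction_gen generalizing w with
  | one => simp
  | mul_gen g s ih => simp [ih, length_grigAct]

/-- The section of a generator at a vertex, as an element of `GrigCover`. -/
def sectGen : GrigGen → List Bool → GrigCover
  | s, [] => gen s
  | .a, _ :: _ => 1
  | .b, false :: w => sectGen .a w
  | .b, true :: w => sectGen .c w
  | .c, false :: w => sectGen .a w
  | .c, true :: w => sectGen .d w
  | .d, false :: _ => 1
  | .d, true :: w => sectGen .b w

theorem sectGen_mul_self (s : GrigGen) (w : List Bool) :
    sectGen s (grigAct s w) * sectGen s w = 1 := by
  induction w generalizing s with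
  | nil => cases s <;> simp [grigAct, sectGen]
  | cons x w ih => cases s <;> cases x <;> simp [grigAct, sectGen, ih]

theorem gen_d_b_c : gen d * gen b * gen c = 1 := by
  have h := gen_b_c_d
  rw [mul_eq_one_iff_eq_inv, gen_inv] at h
  rw [mul_assoc, h, gen_mul_self]

theorem gen_c_d_b : gen c * gen d * gen b = 1 := by
  have h := gen_d_b_c
  rw [mul_eq_one_iff_eq_inv, gen_inv] at h
  rw [mul_assoc, h, gen_mul_self]

theorem sectGen_b_c_d (w : List Bool) :
    sectGen b (grigAct c (grigAct d w)) * sectGen c (grigAct d w) * sectGen d w = 1 := by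
  suffices h : ∀ w,
      sectGen b (grigAct c (grigAct d w)) * sectGen c (grigAct d w) * sectGen d w = 1 ∧
      sectGen c (grigAct d (grigAct b w)) * sectGen d (grigAct b w) * sectGen b w = 1 ∧
      sectGen d (grigAct b (grigAct c w)) * sectGen b (grigAct c w) * sectGen c w = 1 from
    (h w).1
  intro w
  induction w with
  | nil => exact ⟨gen_b_c_d, gen_c_d_b, gen_d_b_c⟩
  | cons x w ih =>
    have ha := sectGen_mul_self a w
    cases x <;> simp [grigAct, sectGen, ih, ha]

/-- The action of `GrigCover` on the product of the tree and of `GrigCover` which encodes the wreath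
recursion: `g` sends `(v, h)` to `(g v, g|ᵥ h)`, where `g|ᵥ` is the section of `g` at `v`. -/
def treePerm : GrigCover →* Equiv.Perm (List Bool × GrigCover) :=
  have hinv (s : GrigGen) : Function.Involutive fun x : List Bool × GrigCover =>
      (grigAct s x.1, sectGen s x.1 * x.2) := fun x => by
    ext1
    · exact grigAct_involutive s x.1
    · simp only [← mul_assoc, sectGen_mul_self, one_mul]
  lift (fun s => (hinv s).toPerm) (fun s => Equiv.ext (hinv s)) (Equiv.ext fun x => by
    ext1
    · exact grigAct_b_c_d x.1
    · simp only [Equiv.Perm.coe_mul, Function.Involutive.coe_toPerm, Function.comp_apply,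
        ← mul_assoc, sectGen_b_c_d, one_mul, Equiv.Perm.coe_one, id_eq])

theorem treePerm_gen (s : GrigGen) (x : List Bool × GrigCover) :
    treePerm (gen s) x = (grigAct s x.1, sectGen s x.1 * x.2) := by
  rw [treePerm, lift_gen]
  rfl

/-- The section of an element of `GrigCover` at a vertex of the tree. -/
def sect (g : GrigCover) (v : List Bool) : GrigCover := (treePerm g (v, 1)).2

theorem treePerm_apply (g : GrigCover) (v : List Bool) (h : GrigCover) :
    treePerm g (v, h) = (toPerm g v, sect g v * h) := by
  induction g using induction_gen generalizing v h with
  | one => simp [sect]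
  | mul_gen g s ih =>
    have key : ∀ h, treePerm (g * gen s) (v, h) =
        (toPerm (g * gen s) v, sect g (grigAct s v) * sectGen s v * h) := fun h => by
      simp [treePerm_gen, ih, mul_assoc]
    rw [key h, show sect (g * gen s) v = _ from congrArg Prod.snd (key 1), mul_one]

@[simp]
theorem sect_one (v : List Bool) : sect 1 v = 1 := by simp [sect]

theorem sect_gen (s : GrigGen) (v : List Bool) : sect (gen s) v = sectGen s v := by
  simp [sect, treePerm_gen]

theorem sect_mul (g h : GrigCover) (v : List Bool) :
    sect (g * h) v = sect g (toPerm h v) * sect h v := by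
  rw [sect, map_mul, Equiv.Perm.mul_apply, treePerm_apply, treePerm_apply, mul_one]

@[simp]
theorem sect_nil (g : GrigCover) : sect g [] = g := by
  induction g using induction_gen with
  | one => simp
  | mul_gen g s ih => cases s <;> simp [sect_mul, sect_gen, sectGen, grigAct, ih]

theorem sect_cons (g : GrigCover) (x : Bool) (w : List Bool) :
    sect g (x :: w) = sect (sect g [x]) w := by
  induction g using induction_gen generalizing x w with
  | one => simp
  | mul_gen g s ih =>
    simp only [sect_mul, sect_gen, toPerm_gen]
    cases s <;> cases x <;> simp [sectGen, grigAct, ih _ (grigAct _ _), ih _ w, sect_gen]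

theorem toPerm_cons (g : GrigCover) (x : Bool) (w : List Bool) :
    toPerm g (x :: w) = toPerm g [x] ++ toPerm (sect g [x]) w := by
  induction g using induction_gen generalizing x w with
  | one => simp
  | mul_gen g s ih =>
    simp only [sect_mul, sect_gen, toPerm_gen, map_mul, Equiv.Perm.mul_apply]
    cases s <;> cases x <;> simp [sectGen, grigAct, ih _ (grigAct _ _), ih _ w]

/-! ### Contraction -/

/-- `WordLe n g` states that `g` is a product of at most `n` generators. -/
inductive WordLe : ℕ → GrigCover → Prop
  | one (n : ℕ) : WordLe n 1
  | mul_gen {n : ℕ} {g : GrigCover} (s : GrigGen) : WordLe n g → WordLe (n + 1) (g * gen s)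

theorem WordLe.mono {m n : ℕ} {g : GrigCover} (h : WordLe m g) (hmn : m ≤ n) : WordLe n g := by
  induction h generalizing n with
  | one => exact .one n
  | mul_gen s _ ih =>
    obtain ⟨n, rfl⟩ : ∃ k, n = k + 1 := ⟨n - 1, by omega⟩
    exact .mul_gen s (ih (by omega))

theorem exists_wordLe (g : GrigCover) : ∃ n, WordLe n g := by
  induction g using induction_gen with
  | one => exact ⟨0, .one 0⟩
  | mul_gen g s ih =>
    obtain ⟨n, hn⟩ := ih
    exact ⟨n + 1, .mul_gen s hn⟩

/-- The Klein four-group `{1, b, c, d}` in `GrigCover`. -/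
def klein : ℤˣ × ℤˣ →* GrigCover where
  toFun v := (if v.1 = 1 then 1 else gen b) * (if v.2 = 1 then 1 else gen c)
  map_one' := by simp
  map_mul' := by
    have hbc : gen c * gen b = gen b * gen c := by
      have h := gen_b_c_d
      rw [mul_eq_one_iff_eq_inv, gen_inv] at h
      have h' := congrArg (·⁻¹) h
      rw [mul_inv_rev, gen_inv, gen_inv, gen_inv] at h'
      rw [h, h']
    have hbc' (x : GrigCover) : gen c * (gen b * x) = gen b * (gen c * x) := by
      rw [← mul_assoc, hbc, mul_assoc]
    rintro ⟨u, v⟩ ⟨u', v'⟩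
    rcases Int.units_eq_one_or u with rfl | rfl <;> rcases Int.units_eq_one_or v with rfl | rfl <;>
    rcases Int.units_eq_one_or u' with rfl | rfl <;>
    rcases Int.units_eq_one_or v' with rfl | rfl <;>
    simp [hbc, hbc', mul_assoc]

theorem klein_b : klein (-1, 1) = gen b := by simp [klein]

theorem klein_c : klein (1, -1) = gen c := by simp [klein]

theorem klein_d : klein (-1, -1) = gen d := by
  have h := gen_b_c_d
  rw [mul_eq_one_iff_eq_inv, gen_inv] at h
  simp [klein, h]

theorem klein_cases (v : ℤˣ × ℤˣ) : klein v = 1 ∨ klein v = gen b ∨ klein v = gen c ∨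
    klein v = gen d := by
  obtain ⟨u, v⟩ := v
  rcases Int.units_eq_one_or u with rfl | rfl <;> rcases Int.units_eq_one_or v with rfl | rfl
  · exact Or.inl (map_one klein)
  · exact Or.inr (Or.inr (Or.inl klein_c))
  · exact Or.inr (Or.inl klein_b)
  · exact Or.inr (Or.inr (Or.inr klein_d))

theorem gen_eq_a_or_klein (s : GrigGen) : s = a ∨ ∃ v, gen s = klein v := by
  cases s
  · exact Or.inl rfl
  · exact Or.inr ⟨_, klein_b.symm⟩
  · exact Or.inr ⟨_, klein_c.symm⟩
  · exact Or.inr ⟨_, klein_d.symm⟩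

/-- `Alternating β n g` states that `g` is a product of `n` factors taken alternately in `{1, a}`
and in `{1, b, c, d}`, the last of them in `{1, b, c, d}` if `β` is `true` and in `{1, a}` if `β` is
`false`. -/
inductive Alternating : Bool → ℕ → GrigCover → Prop
  | one (β : Bool) : Alternating β 0 1
  | mul_one {n : ℕ} {g : GrigCover} : Alternating true n g → Alternating false (n + 1) g
  | mul_a {n : ℕ} {g : GrigCover} : Alternating true n g → Alternating false (n + 1) (g * gen a)
  | mul_klein {n : ℕ} {g : GrigCover} (v : ℤˣ × ℤˣ) :
      Alternating false n g → Alternating true (n + 1) (g * klein v)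

theorem Alternating.mul_gen_a {n : ℕ} {β : Bool} {g : GrigCover} (h : Alternating β n g) :
    ∃ γ, Alternating γ (n + 1) (g * gen a) := by
  cases h with
  | one => exact ⟨_, .mul_a (.one _)⟩
  | mul_one h => exact ⟨true, by simpa using Alternating.mul_klein 1 (.mul_a h)⟩
  | mul_a h => exact ⟨true, by simpa [mul_assoc] using Alternating.mul_klein 1 (.mul_one h)⟩
  | mul_klein v h => exact ⟨_, .mul_a (.mul_klein v h)⟩

theorem Alternating.mul_gen_klein {n : ℕ} {β : Bool} {g : GrigCover} (h : Alternating β n g)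
    (w : ℤˣ × ℤˣ) : ∃ γ, Alternating γ (n + 1) (g * klein w) := by
  cases h with
  | one => exact ⟨_, .mul_klein w (.one _)⟩
  | mul_one h => exact ⟨_, .mul_klein w (.mul_one h)⟩
  | mul_a h => exact ⟨_, .mul_klein w (.mul_a h)⟩
  | mul_klein v h =>
    refine ⟨false, .mul_one ?_⟩
    rw [mul_assoc, ← map_mul]
    exact .mul_klein _ h

theorem WordLe.alternating {n : ℕ} {g : GrigCover} (h : WordLe n g) : ∃ β, Alternating β n g := by
  induction h with
  | one n =>
    induction n with
    | zero => exact ⟨true, .one _⟩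
    | succ n ih =>
      obtain ⟨β, hβ⟩ := ih
      simpa using hβ.mul_gen_klein 1
  | mul_gen s _ ih =>
    obtain ⟨β, hβ⟩ := ih
    obtain rfl | ⟨v, hv⟩ := gen_eq_a_or_klein s
    · exact hβ.mul_gen_a
    · rw [hv]
      exact hβ.mul_gen_klein v

theorem sect_klein_singleton (v : ℤˣ × ℤˣ) (x : Bool) :
    sect (klein v) [x] = 1 ∨ ∃ s, sect (klein v) [x] = gen s := by
  rcases klein_cases v with h | h | h | h <;> rw [h] <;> cases x <;> simp [sect_gen, sectGen]

theorem exists_toPerm_singleton (g : GrigCover) (x : Bool) : ∃ y, toPerm g [x] = [y] :=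
  List.length_eq_one_iff.1 (length_toPerm g [x])

/-- Only the factors in `{1, b, c, d}` contribute to the sections at the first level, each of them
by one generator at most. -/
theorem Alternating.wordLe_sect {n : ℕ} {β : Bool} {g : GrigCover} (h : Alternating β n g)
    (x : Bool) : WordLe ((n + if β then 1 else 0) / 2) (sect g [x]) := by
  induction h generalizing x with
  | one => simpa using .one _
  | mul_one _ ih => exact (ih x).mono (by simp)
  | @mul_a n g _ ih =>
    rw [sect_mul, sect_gen, toPerm_gen]
    simpa [sectGen, grigAct] using ih (!x)
  | @mul_klein n g v _ ih =>
    rw [sect_mul]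
    obtain ⟨y, hy⟩ := exists_toPerm_singleton (klein v) x
    have hn : (n + 1 + if true then 1 else 0) / 2 = n / 2 + 1 := by simp; omega
    have hg : WordLe (n / 2) (sect g [y]) := by simpa using ih y
    rw [hy, hn]
    obtain h | ⟨s, h⟩ := sect_klein_singleton v x <;> rw [h]
    · rw [_root_.mul_one]
      exact hg.mono (by omega)
    · exact hg.mul_gen s

theorem toPerm_gen_ne_one (s : GrigGen) : toPerm (gen s) ≠ 1 := by
  intro h
  have h (w) : grigAct s w = w := by rw [← toPerm_gen, h]; rfl
  have h₁ := h [true, false, false]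
  have h₂ := h [false, false]
  cases s <;> simp [grigAct] at h₁ h₂

/-- The kernel of the action on the tree is exhausted by the elements whose sections at some level
are trivial: the sections of an element of length `n ≥ 2` at the first level have length at most
`(n + 1) / 2 < n`, and no generator acts trivially. -/
theorem exists_forall_sect_eq_one {g : GrigCover} (hg : toPerm g = 1) :
    ∃ N, ∀ v : List Bool, N ≤ v.length → sect g v = 1 := by
  obtain ⟨n, hn⟩ := exists_wordLe g
  induction n using Nat.strong_induction_on generalizing g with
  | _ n ih =>
  by_cases h2 : n < 2
  · obtain rfl : g = 1 := by
      cases hn with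
      | one => rfl
      | @mul_gen m g' s hg' =>
        obtain rfl : m = 0 := by omega
        cases hg'
        rw [one_mul] at hg
        exact absurd hg (toPerm_gen_ne_one s)
    exact ⟨0, fun v _ => sect_one v⟩
  · have key (x : Bool) : ∃ N, ∀ v : List Bool, N ≤ v.length → sect (sect g [x]) v = 1 := by
      obtain ⟨β, hβ⟩ := hn.alternating
      refine ih ((n + 1) / 2) (by omega) (Equiv.ext fun w => ?_)
        ((hβ.wordLe_sect x).mono (by split <;> omega))
      have h := toPerm_cons g x w
      simpa [hg] using h.symm
    choose N hN using key
    refine ⟨max (N false) (N true) + 1, fun v hv => ?_⟩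
    cases v with
    | nil => simp at hv
    | cons x v =>
      rw [sect_cons]
      refine hN x v ?_
      have : N x ≤ max (N false) (N true) := by cases x <;> simp
      simp only [List.length_cons] at hv
      omega

/-! ### Self-replication -/

theorem exists_sect_true_eq (g : GrigCover) :
    ∃ h, toPerm h [true] = [true] ∧ sect h [true] = g := by
  induction g using induction_gen with
  | one => exact ⟨1, by simp⟩
  | mul_gen g s ih =>
    obtain ⟨h, h₁, h₂⟩ := ih
    have key (k : GrigCover) (hk : toPerm k [true] = [true] ∧ sect k [true] = gen s) :
        ∃ h, toPerm h [true] = [true] ∧ sect h [true] = g * gen s :=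
      ⟨h * k, by simp [hk, h₁], by simp [sect_mul, hk, h₂]⟩
    cases s
    · refine key (gen a * gen b * gen a) ?_
      simp [sect_mul, sect_gen, grigAct, sectGen]
    · refine key (gen d) ?_
      simp [sect_gen, grigAct, sectGen]
    · refine key (gen b) ?_
      simp [sect_gen, grigAct, sectGen]
    · refine key (gen c) ?_
      simp [sect_gen, grigAct, sectGen]

/-- The stabilizer of a vertex of the rightmost ray maps onto `GrigCover` by taking sections. -/
theorem exists_sect_replicate_eq (n : ℕ) (g : GrigCover) :
    ∃ h, toPerm h (List.replicate n true) = List.replicate n true ∧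
      sect h (List.replicate n true) = g := by
  induction n with
  | zero => exact ⟨g, List.eq_nil_of_length_eq_zero (by simp [length_toPerm]), by simp⟩
  | succ n ih =>
    obtain ⟨h, h₁, h₂⟩ := ih
    obtain ⟨k, k₁, k₂⟩ := exists_sect_true_eq h
    refine ⟨k, ?_, ?_⟩
    · rw [List.replicate_succ, toPerm_cons, k₁, k₂, h₁]
      rfl
    · rw [List.replicate_succ, sect_cons, k₂, h₂]

end GrigCover

/-! ### Perfect subgroups -/

theorem Subgroup.map_le_commutator_of_le {G H : Type*} [Group G] [Group H] (f : G →* H)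
    {P : Subgroup G} (hP : P ≤ ⁅P, P⁆) : P.map f ≤ ⁅P.map f, P.map f⁆ := by
  rw [← Subgroup.map_commutator]
  exact Subgroup.map_mono hP

theorem Subgroup.eq_bot_of_le_commutator_of_comm {G : Type*} [CommGroup G] {P : Subgroup G}
    (hP : P ≤ ⁅P, P⁆) : P = ⊥ := by
  refine le_bot_iff.1 (hP.trans ?_)
  rw [Subgroup.commutator_le]
  intro x _ y _
  simp [commutatorElement_def]

/-- A perfect subgroup of a free group is trivial, since it is itself free. -/
theorem FreeGroup.eq_bot_of_le_commutator {X : Type*} {P : Subgroup (FreeGroup X)}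
    (hP : P ≤ ⁅P, P⁆) : P = ⊥ := by
  let e := IsFreeGroup.toFreeGroup P
  have hcomm : commutator P = ⊤ := by
    have h : (commutator P).map P.subtype = P := by
      rw [Subgroup.map_subtype_commutator]
      exact le_antisymm (Subgroup.commutator_le_self P) hP
    rw [eq_top_iff]
    intro x _
    have hx : (x : FreeGroup X) ∈ (commutator P).map P.subtype := by rw [h]; exact x.2
    obtain ⟨y, hy, hyx⟩ := hx
    rwa [← Subtype.ext hyx]
  have hempty : IsEmpty (IsFreeGroup.Generators P) := by
    refine ⟨fun i => ?_⟩
    let f : P →* Multiplicative ℤ :=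
      IsFreeGroup.lift fun _ => Multiplicative.ofAdd 1
    have hf : commutator P ≤ f.ker := Abelianization.commutator_subset_ker f
    have h : f (IsFreeGroup.of i) = 1 := hf (hcomm ▸ Subgroup.mem_top _)
    rw [IsFreeGroup.lift_of] at h
    exact one_ne_zero (Multiplicative.ofAdd.injective h)
  rw [Subgroup.eq_bot_iff_forall]
  intro x hx
  have : (⟨x, hx⟩ : P) = 1 := e.injective (Subsingleton.elim _ _)
  exact congrArg Subtype.val this

/-! ### An embedding of the free product in a virtually free semidirect product -/

namespace GrigCover

open GrigGen

/-- The free group on the Klein four-group, realized as `ℤˣ × ℤˣ`. -/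
abbrev KleinFree : Type := FreeGroup (ℤˣ × ℤˣ)

/-- The action of `(w, ε)` sends the basis element `x_v` to `x_{wv}` to the power `ε`. -/
instance : MulDistribMulAction ((ℤˣ × ℤˣ) × ℤˣ) KleinFree where
  smul q := FreeGroup.lift fun v => FreeGroup.of (q.1 * v) ^ (q.2 : ℤ)
  one_smul x := by
    have h : FreeGroup.lift (fun v : ℤˣ × ℤˣ => FreeGroup.of (1 * v) ^ ((1 : ℤˣ) : ℤ)) =
        MonoidHom.id KleinFree := by
      ext v
      simp
    exact DFunLike.congr_fun h x
  mul_smul q q' x := by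
    change FreeGroup.lift _ x = FreeGroup.lift _ (FreeGroup.lift _ x)
    rw [← MonoidHom.comp_apply]
    congr 1
    ext v
    simp [zpow_mul, mul_assoc]
  smul_mul q x y := map_mul _ x y
  smul_one q := map_one _

theorem smul_of (q : (ℤˣ × ℤˣ) × ℤˣ) (v : ℤˣ × ℤˣ) :
    q • (FreeGroup.of v : KleinFree) = FreeGroup.of (q.1 * v) ^ (q.2 : ℤ) :=
  FreeGroup.lift_apply_of

/-- A semidirect product of a free group by an elementary abelian group of order eight. -/
abbrev VirtFree : Type :=
  KleinFree ⋊[MulDistribMulAction.toMulAut ((ℤˣ × ℤˣ) × ℤˣ) KleinFree] ((ℤˣ × ℤˣ) × ℤˣ)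

/-- The images of the generators of `GrigCover` in `VirtFree`. -/
def genVirtFree : GrigGen → VirtFree
  | .a => ⟨FreeGroup.of 1, (1, -1)⟩
  | .b => ⟨1, ((-1, 1), 1)⟩
  | .c => ⟨1, ((1, -1), 1)⟩
  | .d => ⟨1, ((-1, -1), 1)⟩

/-- The embedding of `GrigCover` in `VirtFree`. -/
def toVirtFree : GrigCover →* VirtFree :=
  lift genVirtFree
    (fun s => by cases s <;> ext <;> simp [genVirtFree, smul_of])
    (by ext <;> simp [genVirtFree])

/-- A set-theoretic section of the projection of `GrigCover` to `(ℤˣ × ℤˣ) × ℤˣ`. -/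
def ofQuot (q : (ℤˣ × ℤˣ) × ℤˣ) : GrigCover := (if q.2 = 1 then 1 else gen a) * klein q.1

/-- The homomorphism which sends `x_v` to `[v, a]`. -/
def ofKleinFree : KleinFree →* GrigCover :=
  FreeGroup.lift fun v => klein v * gen a * (klein v)⁻¹ * gen a

theorem ofKleinFree_of (v : ℤˣ × ℤˣ) :
    ofKleinFree (FreeGroup.of v) = klein v * gen a * (klein v)⁻¹ * gen a :=
  FreeGroup.lift_apply_of

/-- The map `(x, q) ↦ ofKleinFree x * ofQuot q` is a left inverse of `toVirtFree`. -/
theorem ofKleinFree_mul_ofQuot (g : GrigCover) :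
    ofKleinFree (toVirtFree g).left * ofQuot (toVirtFree g).right = g := by
  induction g using induction_gen with
  | one => simp [ofQuot]
  | mul_gen g s ih =>
    have key (q : (ℤˣ × ℤˣ) × ℤˣ) :
        ofKleinFree (q • (genVirtFree s).left) * ofQuot (q * (genVirtFree s).right) =
          ofQuot q * gen s := by
      have hk (v : ℤˣ × ℤˣ) (hv : klein v = gen s) (hs : genVirtFree s = ⟨1, (v, 1)⟩) :
          ofKleinFree (q • (genVirtFree s).left) * ofQuot (q * (genVirtFree s).right) =
            ofQuot q * gen s := by
        simp [hs, ofQuot, hv, mul_assoc]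
      cases s
      · obtain ⟨v, ε⟩ := q
        rcases Int.units_eq_one_or ε with rfl | rfl <;>
        simp [genVirtFree, smul_of, ofQuot, ofKleinFree_of, mul_assoc]
      · exact hk _ klein_b rfl
      · exact hk _ klein_c rfl
      · exact hk _ klein_d rfl
    have hs : toVirtFree (gen s) = genVirtFree s := lift_gen ..
    rw [map_mul, SemidirectProduct.mul_left, SemidirectProduct.mul_right, map_mul, hs, mul_assoc]
    exact (congrArg _ (key _)).trans (by rw [← mul_assoc, ih])

theorem toVirtFree_injective : Function.Injective toVirtFree := fun g h hgh => by
  rw [← ofKleinFree_mul_ofQuot g, hgh, ofKleinFree_mul_ofQuot]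

/-- A perfect subgroup of `GrigCover` is trivial. -/
theorem eq_bot_of_le_commutator {P : Subgroup GrigCover} (hP : P ≤ ⁅P, P⁆) : P = ⊥ := by
  have h₁ := Subgroup.map_le_commutator_of_le toVirtFree hP
  set P' := P.map toVirtFree with hP'
  have h₂ := Subgroup.eq_bot_of_le_commutator_of_comm
    (Subgroup.map_le_commutator_of_le SemidirectProduct.rightHom h₁)
  have h₃ : P' ≤ (SemidirectProduct.inl : KleinFree →* VirtFree).range := by
    rw [SemidirectProduct.range_inl_eq_ker_rightHom]
    exact (Subgroup.map_eq_bot_iff _).1 h₂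
  have h₄ : (P'.comap SemidirectProduct.inl).map SemidirectProduct.inl = P' :=
    Subgroup.map_comap_eq_self h₃
  have h₅ : P'.comap SemidirectProduct.inl = (⊥ : Subgroup KleinFree) := by
    refine FreeGroup.eq_bot_of_le_commutator ?_
    rw [← Subgroup.map_le_map_iff_of_injective
      (f := (SemidirectProduct.inl : KleinFree →* VirtFree)) SemidirectProduct.inl_injective,
      Subgroup.map_commutator, h₄]
    exact h₁
  rw [h₅, Subgroup.map_bot] at h₄
  exact (Subgroup.map_eq_bot_iff_of_injective _ toVirtFree_injective).1 h₄.symm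

/-! ### Largeness -/

theorem isLargeGroup : IsLargeGroup GrigCover := by
  let ρ : GrigCover →* (ℤˣ × ℤˣ) × ℤˣ := SemidirectProduct.rightHom.comp toVirtFree
  -- The quotient of the free group by `x_1` and `x_d` is free on the images of `x_b` and `x_c`.
  let φ : KleinFree →* FreeGroup Bool := FreeGroup.lift fun v =>
    if v = (-1, 1) then FreeGroup.of false else if v = (1, -1) then FreeGroup.of true else 1
  let f : ρ.ker →* FreeGroup Bool :=
    { toFun := fun g => φ (toVirtFree g).left
      map_one' := by simp
      map_mul' := fun g h => by
        have hg : (toVirtFree g).right = 1 := g.2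
        simp [hg] }
  refine ⟨ρ.ker, inferInstance, Bool, inferInstance, f, ?_⟩
  have hgen (v : ℤˣ × ℤˣ) : toVirtFree (klein v) = ⟨1, (v, 1)⟩ := by
    obtain ⟨u, v⟩ := v
    rcases Int.units_eq_one_or u with rfl | rfl <;> rcases Int.units_eq_one_or v with rfl | rfl
    · exact map_one _
    · exact (congrArg _ klein_c).trans (lift_gen ..)
    · exact (congrArg _ klein_b).trans (lift_gen ..)
    · exact (congrArg _ klein_d).trans (lift_gen ..)
  have ha : toVirtFree (gen a) = ⟨FreeGroup.of 1, (1, -1)⟩ := lift_gen ..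
  have key (v : ℤˣ × ℤˣ) : toVirtFree (klein v * gen a * klein v * gen a) =
      ⟨FreeGroup.of v * (FreeGroup.of 1)⁻¹, 1⟩ := by
    have hv : v * v = 1 := by
      ext <;> simp
    ext
    · simp [hgen, ha, smul_of, hv]
    · simp [hgen, ha, hv]
    · simp [hgen, ha, hv]
    · simp [hgen, ha, hv]
  rw [← MonoidHom.range_eq_top, eq_top_iff, ← FreeGroup.closure_range_of, Subgroup.closure_le]
  rintro _ ⟨i, rfl⟩
  let v : ℤˣ × ℤˣ := if i then (1, -1) else (-1, 1)
  refine ⟨⟨klein v * gen a * klein v * gen a, congrArg SemidirectProduct.right (key v)⟩, ?_⟩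
  change φ (toVirtFree _).left = _
  rw [key]
  have h₁ : (1 : ℤˣ × ℤˣ) ≠ (-1, 1) := by decide
  have h₂ : (1 : ℤˣ × ℤˣ) ≠ (1, -1) := by decide
  cases i <;> simp [φ, v, h₁, h₂]

end GrigCover

theorem IsLargeGroup.of_surjective {E : Type*} {Γ : Type*} [Group E] [Group Γ]
    (hΓ : IsLargeGroup Γ) {H : Subgroup E} (hH : H.FiniteIndex) (f : H →* Γ)
    (hf : Function.Surjective f) : IsLargeGroup E := by
  obtain ⟨K, hK, X, hX, φ, hφ⟩ := hΓ
  let L : Subgroup H := K.comap f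
  let e : L ≃* L.map H.subtype := L.equivMapOfInjective _ H.subtype_injective
  refine ⟨L.map H.subtype, ⟨?_⟩, X, hX, (φ.comp (f.subgroupComap K)).comp e.symm.toMonoidHom, ?_⟩
  · rw [Subgroup.index_map_subtype]
    refine mul_ne_zero ?_ hH.index_ne_zero
    rw [Subgroup.index_comap_of_surjective _ hf]
    exact hK.index_ne_zero
  · refine (hφ.comp ?_).comp e.symm.surjective
    rintro ⟨k, hk⟩
    obtain ⟨h, rfl⟩ := hf k
    exact ⟨⟨h, hk⟩, rfl⟩

/-! ### Finite presentation and projective resolutions -/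

/-- A form of Schanuel's lemma: if `P₁ → P₀ → N → 0` is a partial resolution by finitely generated
projective modules whose kernel `range δ₁` is finitely generated, then the kernel of any surjection
to `N` from a finitely generated projective module is finitely presented. -/
theorem Module.finitePresentation_ker_of_exact {R : Type*} [Ring R] {P₀ P₁ P₂ N Q : Type*}
    [AddCommGroup P₀] [AddCommGroup P₁] [AddCommGroup P₂] [AddCommGroup N] [AddCommGroup Q]
    [Module R P₀] [Module R P₁] [Module R P₂] [Module R N] [Module R Q]
    [Module.Projective R P₀] [Module.Projective R P₁] [Module.Projective R Q]
    [Module.Finite R P₀] [Module.Finite R P₁] [Module.Finite R P₂] [Module.Finite R Q]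
    (δ₁ : P₂ →ₗ[R] P₁) (δ₀ : P₁ →ₗ[R] P₀) (ε : P₀ →ₗ[R] N) (hε : Function.Surjective ε)
    (h₀ : Function.Exact δ₀ ε) (h₁ : Function.Exact δ₁ δ₀)
    (η : Q →ₗ[R] N) (hη : Function.Surjective η) :
    Module.FinitePresentation R (LinearMap.ker η) := by
  obtain ⟨l, hl⟩ := Module.projective_lifting_property η ε hη
  obtain ⟨h, hh⟩ := Module.projective_lifting_property ε η hε
  replace hl (p) : η (l p) = ε p := LinearMap.congr_fun hl p
  replace hh (q) : ε (h q) = η q := LinearMap.congr_fun hh q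
  have : Module.FinitePresentation R P₁ := Module.finitePresentation_of_projective R P₁
  have : Module.FinitePresentation R Q := Module.finitePresentation_of_projective R Q
  have : Module.FinitePresentation R (LinearMap.ker ε) := by
    refine Module.finitePresentation_of_surjective
      (δ₀.codRestrict (LinearMap.ker ε) fun p => LinearMap.mem_ker.2 (h₀.apply_apply_eq_zero p))
      ?_ ?_
    · rintro ⟨p, hp⟩
      obtain ⟨p', rfl⟩ := (h₀ p).1 hp
      exact ⟨p', rfl⟩
    · rw [LinearMap.ker_codRestrict, h₁.linearMap_ker_eq, LinearMap.range_eq_map]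
      exact Module.Finite.fg_top.map δ₁
  -- The map `(k, q) ↦ q - l (k + h q)`, whose kernel is the image of `P₀` under
  -- `p ↦ (p - h (l p), l p)`.
  let Φ : LinearMap.ker ε × Q →ₗ[R] LinearMap.ker η :=
    (LinearMap.snd R _ Q - l ∘ₗ ((LinearMap.ker ε).subtype ∘ₗ LinearMap.fst R _ _ +
      h ∘ₗ LinearMap.snd R _ _)).codRestrict _ (by
        rintro ⟨⟨k, hk⟩, q⟩
        have hk : ε k = 0 := hk
        simp [hl, hh, hk])
  have hΦ (k : LinearMap.ker ε) (q : Q) : (Φ (k, q) : Q) = q - l (k + h q) := rfl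
  refine Module.finitePresentation_of_surjective Φ ?_ ?_
  · rintro ⟨q, hq⟩
    have hq : η q = 0 := hq
    refine ⟨(⟨-h q, by simp [hh, hq]⟩, q), Subtype.ext ?_⟩
    simp [hΦ]
  · let Ψ : P₀ →ₗ[R] LinearMap.ker ε × Q :=
      ((LinearMap.id - h ∘ₗ l).codRestrict (LinearMap.ker ε) (by simp [hl, hh])).prod l
    have hΨ : LinearMap.ker Φ = LinearMap.range Ψ := by
      ext ⟨k, q⟩
      rw [LinearMap.mem_ker, LinearMap.mem_range]
      constructor
      · intro hkq
        have hq : q = l (k + h q) := by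
          rw [← sub_eq_zero, ← hΦ, hkq]
          rfl
        refine ⟨k + h q, Prod.ext (Subtype.ext ?_) hq.symm⟩
        change (k + h q : P₀) - h (l (k + h q)) = k
        rw [← hq, add_sub_cancel_right]
      · rintro ⟨p, hp⟩
        rw [← hp]
        refine Subtype.ext ?_
        change l p - l (p - h (l p) + h (l p)) = 0
        simp
    rw [hΨ, LinearMap.range_eq_map]
    exact Module.Finite.fg_top.map Ψ

/-! ### Relation modules -/

namespace GroupRing

variable {E : Type*} [Group E]

/-- The augmentation of the integral group ring. -/
noncomputable def aug (E : Type*) [Group E] :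
    MonoidAlgebra ℤ E →ₗ[MonoidAlgebra ℤ E] (Representation.trivial ℤ E ℤ).asModule :=
  LinearMap.toSpanSingleton _ _ ((Representation.trivial ℤ E ℤ).asModuleEquiv.symm 1)

theorem aug_single (g : E) (n : ℤ) :
    aug E (MonoidAlgebra.single g n) = (Representation.trivial ℤ E ℤ).asModuleEquiv.symm n := by
  rw [aug, LinearMap.toSpanSingleton_apply, Representation.single_smul]
  simp only [Representation.trivial_apply, LinearEquiv.apply_symm_apply, smul_eq_mul, mul_one]
  rfl

theorem aug_surjective : Function.Surjective (aug E) := fun n =>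
  ⟨MonoidAlgebra.single 1 ((Representation.trivial ℤ E ℤ).asModuleEquiv n), by
    rw [aug_single, LinearEquiv.symm_apply_apply]⟩

theorem add_induction {p : MonoidAlgebra ℤ E → Prop} (x : MonoidAlgebra ℤ E)
    (of : ∀ g, p (MonoidAlgebra.of ℤ E g)) (add : ∀ x y, p x → p y → p (x + y))
    (neg : ∀ x, p x → p (-x)) : p x := by
  have zero : p 0 := by
    rw [← add_neg_cancel (MonoidAlgebra.of ℤ E 1)]
    exact add _ _ (of 1) (neg _ (of 1))
  let A : AddSubgroup (MonoidAlgebra ℤ E) :=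
    { carrier := {x | p x}
      add_mem' := add _ _
      zero_mem' := zero
      neg_mem' := neg _ }
  change x ∈ A
  induction x using MonoidAlgebra.induction_on with
  | of g => exact of g
  | add x y hx hy => exact add _ _ hx hy
  | smul n x hx => exact A.zsmul_mem hx n

section FreeGroup

variable {S : Type*} (α : FreeGroup S →* E)

/-- The boundary `Z[E]^S → Z[E]`, `e_s ↦ s - 1`. -/
noncomputable def boundary : (S →₀ MonoidAlgebra ℤ E) →ₗ[MonoidAlgebra ℤ E] MonoidAlgebra ℤ E :=
  Finsupp.linearCombination _ fun s => MonoidAlgebra.of ℤ E (α (FreeGroup.of s)) - 1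

/-- The affine bijection `m ↦ g m + x` of `Z[E]^S`. -/
noncomputable def affine (g : E) (x : S →₀ MonoidAlgebra ℤ E) :
    Equiv.Perm (S →₀ MonoidAlgebra ℤ E) where
  toFun m := MonoidAlgebra.of ℤ E g • m + x
  invFun m := MonoidAlgebra.of ℤ E g⁻¹ • (m - x)
  left_inv m := by simp [smul_smul, ← MonoidAlgebra.one_def]
  right_inv m := by simp [smul_smul, ← MonoidAlgebra.one_def]

/-- The action of the free group on `Z[E]^S` for which a free generator `s` acts by
`m ↦ s m + e_s`. -/
noncomputable def affineAction : FreeGroup S →* Equiv.Perm (S →₀ MonoidAlgebra ℤ E) :=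
  FreeGroup.lift fun s => affine (α (FreeGroup.of s)) (Finsupp.single s 1)

/-- The crossed homomorphism whose coordinates are the Fox derivatives. -/
noncomputable def fox (f : FreeGroup S) : S →₀ MonoidAlgebra ℤ E := affineAction α f 0

theorem affineAction_apply (f : FreeGroup S) (m : S →₀ MonoidAlgebra ℤ E) :
    affineAction α f m = MonoidAlgebra.of ℤ E (α f) • m + fox α f := by
  induction f using FreeGroup.induction_on generalizing m with
  | C1 => simp [fox, ← MonoidAlgebra.one_def]
  | of s => simp [fox, affineAction, affine]
  | inv_of s ih =>
    have h (m) : affineAction α (FreeGroup.of s)⁻¹ m = MonoidAlgebra.of ℤ E (α (FreeGroup.of s))⁻¹ •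
        (m - Finsupp.single s 1) := by
      simp [affineAction]
      rfl
    rw [fox, h, h, map_inv α, ← smul_add]
    simp [sub_eq_add_neg]
  | mul f f' h h' =>
    rw [fox, map_mul, Equiv.Perm.mul_apply, Equiv.Perm.mul_apply, h', h, h', h, map_mul, map_mul]
    simp only [smul_add, mul_smul, smul_zero, zero_add, add_assoc]

@[simp]
theorem fox_one : fox α 1 = 0 := by simp [fox]

theorem fox_of (s : S) : fox α (FreeGroup.of s) = Finsupp.single s 1 := by
  simp [fox, affineAction, affine]

theorem fox_mul (f f' : FreeGroup S) :
    fox α (f * f') = MonoidAlgebra.of ℤ E (α f) • fox α f' + fox α f := by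
  rw [fox, map_mul, Equiv.Perm.mul_apply, affineAction_apply]
  rfl

theorem fox_inv (f : FreeGroup S) :
    fox α f⁻¹ = -(MonoidAlgebra.of ℤ E (α f)⁻¹ • fox α f) := by
  have h := fox_mul α f⁻¹ f
  rw [inv_mul_cancel, fox_one, map_inv] at h
  exact eq_neg_of_add_eq_zero_right h.symm

/-- The fundamental formula of Fox calculus. -/
theorem boundary_fox (f : FreeGroup S) :
    boundary α (fox α f) = MonoidAlgebra.of ℤ E (α f) - 1 := by
  induction f using FreeGroup.induction_on with
  | C1 => simp [← MonoidAlgebra.one_def]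
  | of s => simp [fox_of, boundary]
  | inv_of s ih =>
    rw [fox_inv, map_neg, map_smul, ih, smul_eq_mul, mul_sub, ← map_mul]
    simp [← MonoidAlgebra.one_def]
  | mul f f' h h' =>
    rw [fox_mul, map_add, map_smul, h, h', smul_eq_mul, mul_sub, ← map_mul, map_mul α]
    simp

theorem aug_of_sub_one (g : E) : aug E (MonoidAlgebra.of ℤ E g - 1) = 0 := by
  rw [map_sub, MonoidAlgebra.one_def, MonoidAlgebra.of_apply, aug_single, aug_single, sub_self]

variable {α}

theorem range_boundary (hα : Function.Surjective α) :
    LinearMap.range (boundary α) = LinearMap.ker (aug E) := by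
  apply le_antisymm
  · rintro _ ⟨m, rfl⟩
    rw [LinearMap.mem_ker, boundary, Finsupp.linearCombination_apply, map_finsuppSum]
    refine Finset.sum_eq_zero fun s _ => ?_
    dsimp only
    rw [map_smul, aug_of_sub_one, smul_zero]
  · have h (x : MonoidAlgebra ℤ E) : x - MonoidAlgebra.single 1
        ((Representation.trivial ℤ E ℤ).asModuleEquiv (aug E x)) ∈
          LinearMap.range (boundary α) := by
      induction x using add_induction with
      | of g =>
        obtain ⟨f, rfl⟩ := hα g
        rw [MonoidAlgebra.of_apply, aug_single]
        exact ⟨fox α f, boundary_fox α f⟩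
      | add x y hx hy =>
        rw [map_add, map_add, MonoidAlgebra.single_add, add_sub_add_comm]
        exact add_mem hx hy
      | neg x hx =>
        rw [map_neg, map_neg, MonoidAlgebra.single_neg, ← neg_sub']
        exact neg_mem hx
    intro x hx
    have hx : aug E x = 0 := hx
    simpa [hx] using h x

end FreeGroup

/-- The additive map on the integral group ring which extends a map on the group. -/
noncomputable def liftAdd {A : Type*} [AddCommGroup A] (φ : E → A) : MonoidAlgebra ℤ E →+ A :=
  (Finsupp.liftAddHom fun g => zmultiplesHom A (φ g)).comp
    (MonoidAlgebra.coeffAddEquiv : MonoidAlgebra ℤ E ≃+ (E →₀ ℤ)).toAddMonoidHom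

theorem liftAdd_of {A : Type*} [AddCommGroup A] (φ : E → A) (g : E) :
    liftAdd φ (MonoidAlgebra.of ℤ E g) = φ g := by
  change Finsupp.liftAddHom _ (Finsupp.single g (1 : ℤ)) = φ g
  simp

section Relations

variable {S : Type*} {α : FreeGroup S →* E} {t : E → FreeGroup S}

/-- For a section `t` of `α`, the relation `t(g) f t(g α(f))⁻¹`, the loop based at the identity of
the Cayley graph which runs through the path labelled `f` starting from `g`. -/
def loop (ht : ∀ g, α (t g) = g) (g : E) (f : FreeGroup S) : α.ker :=
  ⟨t g * f * (t (g * α f))⁻¹, by simp [MonoidHom.mem_ker, ht]⟩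

/-- The class of `loop ht g f` in the relation module. -/
def loopClass (ht : ∀ g, α (t g) = g) (g : E) (f : FreeGroup S) :
    Additive (Abelianization α.ker) :=
  Additive.ofMul (Abelianization.of (loop ht g f))

theorem loopClass_mul (ht : ∀ g, α (t g) = g) (g : E) (f f' : FreeGroup S) :
    loopClass ht g (f * f') = loopClass ht g f + loopClass ht (g * α f) f' := by
  have h : loop ht g (f * f') = loop ht g f * loop ht (g * α f) f' := by
    ext1
    simp [loop, mul_assoc]
  rw [loopClass, h, map_mul]
  rfl

/-- The additive map from `Z[E]^S` to the relation module which sends `g e_s` to the class of the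
loop `t(g) s t(g s)⁻¹`. -/
noncomputable def toRelModule (ht : ∀ g, α (t g) = g) :
    (S →₀ MonoidAlgebra ℤ E) →+ Additive (Abelianization α.ker) :=
  Finsupp.liftAddHom fun s => liftAdd fun g => loopClass ht g (FreeGroup.of s)

theorem toRelModule_smul_fox (ht : ∀ g, α (t g) = g) (g : E) (f : FreeGroup S) :
    toRelModule ht (MonoidAlgebra.of ℤ E g • fox α f) = loopClass ht g f := by
  have hone (g : E) : loopClass ht g 1 = 0 := by
    simpa using loopClass_mul ht g 1 1
  induction f using FreeGroup.induction_on generalizing g with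
  | C1 => rw [fox_one, smul_zero, map_zero, hone]
  | of s => rw [fox_of, Finsupp.smul_single, smul_eq_mul, mul_one, toRelModule,
      Finsupp.liftAddHom_apply_single, liftAdd_of]
  | inv_of s ih =>
    have h := loopClass_mul ht g (FreeGroup.of s)⁻¹ (FreeGroup.of s)
    rw [inv_mul_cancel, hone, map_inv] at h
    rw [fox_inv, smul_neg, map_neg, smul_smul, ← map_mul, ih, eq_comm]
    exact eq_neg_of_add_eq_zero_left h.symm
  | mul f f' h h' =>
    rw [fox_mul, smul_add, smul_smul, ← map_mul, map_add, h, h', loopClass_mul, add_comm]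

/-- The relation module embeds in `Z[E]^S` by Fox calculus. -/
theorem mem_commutator_of_fox_eq_zero (hα : Function.Surjective α) {r : FreeGroup S}
    (hr : r ∈ α.ker) (h : fox α r = 0) : r ∈ ⁅α.ker, α.ker⁆ := by
  obtain ⟨t, ht⟩ := hα.hasRightInverse
  have h₁ := toRelModule_smul_fox ht 1 r
  rw [h, smul_zero, map_zero] at h₁
  have h₂ : loop ht 1 r = ⟨t 1, ht 1⟩ * ⟨r, hr⟩ * ⟨t 1, ht 1⟩⁻¹ := by
    ext1
    simp [loop, MonoidHom.mem_ker.1 hr]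
  have h₃ : Abelianization.of (⟨r, hr⟩ : α.ker) = 1 := by
    have h₁ : Abelianization.of (loop ht 1 r) = 1 := h₁.symm
    rw [h₂, map_mul, map_mul, map_inv, mul_comm, inv_mul_cancel_left] at h₁
    exact h₁
  have h₄ : (⟨r, hr⟩ : α.ker) ∈ commutator α.ker := by
    rw [← Abelianization.ker_of]
    exact h₃
  rw [← Subgroup.map_subtype_commutator]
  exact ⟨_, h₄, rfl⟩

theorem fox_mul_of_mem_ker {r : FreeGroup S} (hr : r ∈ α.ker) (f : FreeGroup S) :
    fox α (r * f) = fox α r + fox α f := by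
  rw [fox_mul, MonoidHom.mem_ker.1 hr, map_one, one_smul, add_comm]

/-- The kernel of the boundary is the image of the relation module. -/
theorem exists_fox_eq (hα : Function.Surjective α) {m : S →₀ MonoidAlgebra ℤ E}
    (hm : boundary α m = 0) : ∃ r ∈ α.ker, fox α r = m := by
  obtain ⟨t, ht⟩ := hα.hasRightInverse
  let T : MonoidAlgebra ℤ E →+ S →₀ MonoidAlgebra ℤ E := liftAdd fun g => fox α (t g)
  have hT (g : E) : T (MonoidAlgebra.of ℤ E g) = fox α (t g) := liftAdd_of _ g
  have add {m m' : S →₀ MonoidAlgebra ℤ E}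
      (h : ∃ r ∈ α.ker, fox α r = m - T (boundary α m))
      (h' : ∃ r ∈ α.ker, fox α r = m' - T (boundary α m')) :
      ∃ r ∈ α.ker, fox α r = m + m' - T (boundary α (m + m')) := by
    obtain ⟨r, hr, h⟩ := h
    obtain ⟨r', hr', h'⟩ := h'
    refine ⟨r * r', mul_mem hr hr', ?_⟩
    rw [fox_mul_of_mem_ker hr, h, h', map_add, map_add]
    abel
  suffices h : ∃ r ∈ α.ker, fox α r = m - T (boundary α m) by
    simpa [hm] using h
  clear hm
  induction m using Finsupp.induction_linear with
  | zero => exact ⟨1, one_mem _, by simp⟩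
  | add m m' h h' => exact add h h'
  | single s x =>
    induction x using add_induction with
    | of g =>
      have hg : (Finsupp.single s (MonoidAlgebra.of ℤ E g) : S →₀ MonoidAlgebra ℤ E) =
          MonoidAlgebra.of ℤ E g • fox α (FreeGroup.of s) := by
        rw [fox_of, Finsupp.smul_single, smul_eq_mul, mul_one]
      refine ⟨_, (loop ht g (FreeGroup.of s)).2, ?_⟩
      rw [hg, map_smul, boundary_fox, smul_eq_mul, mul_sub, mul_one, ← map_mul, map_sub, hT, hT]
      rw [loop, fox_mul, fox_mul, fox_inv, smul_neg, smul_smul, ← map_mul, map_mul α, ht, ht,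
        mul_inv_cancel, map_one, one_smul]
      abel
    | add x y h h' =>
      rw [Finsupp.single_add]
      exact add h h'
    | neg x h =>
      obtain ⟨r, hr, h⟩ := h
      refine ⟨r⁻¹, inv_mem hr, ?_⟩
      rw [fox_inv, MonoidHom.mem_ker.1 hr, inv_one, map_one, one_smul, h, Finsupp.single_neg,
        map_neg, map_neg]
      abel

/-- If the augmentation ideal is finitely presented, then every presentation with finitely many
generators has finitely many relators which generate the relation module. -/
theorem exists_finite_ker_le (hα : Function.Surjective α) [Finite S]
    (hfp : Module.FinitePresentation (MonoidAlgebra ℤ E) (LinearMap.ker (aug E))) :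
    ∃ R : Set (FreeGroup S), R.Finite ∧ R ⊆ α.ker ∧
      α.ker ≤ Subgroup.normalClosure R ⊔ ⁅α.ker, α.ker⁆ := by
  have hmem (m) : boundary α m ∈ LinearMap.ker (aug E) := by
    rw [← range_boundary hα]
    exact ⟨m, rfl⟩
  have hfg : (LinearMap.ker (boundary α)).FG := by
    rw [← LinearMap.ker_codRestrict _ (boundary α) hmem]
    refine Module.FinitePresentation.fg_ker _ ?_
    rintro ⟨x, hx⟩
    obtain ⟨m, rfl⟩ := (range_boundary hα).ge hx
    exact ⟨m, rfl⟩
  obtain ⟨B, hB⟩ := hfg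
  have hrel (m : B) : ∃ r ∈ α.ker, fox α r = m :=
    exists_fox_eq hα (hB.le (Submodule.subset_span m.2))
  choose ρ hρ hρ' using hrel
  have hsub : Set.range ρ ⊆ α.ker := by
    rintro _ ⟨m, rfl⟩
    exact hρ m
  have hN : Subgroup.normalClosure (Set.range ρ) ≤ α.ker := Subgroup.normalClosure_le_normal hsub
  refine ⟨Set.range ρ, Set.finite_range ρ, hsub, fun r hr => ?_⟩
  -- The Fox derivatives of the normal closure of the chosen relators fill the submodule they span.
  have key (m) (hm : m ∈ Submodule.span (MonoidAlgebra ℤ E) (B : Set (S →₀ MonoidAlgebra ℤ E))) :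
      ∃ r ∈ Subgroup.normalClosure (Set.range ρ), fox α r = m := by
    induction hm using Submodule.span_induction with
    | mem m hm => exact ⟨_, Subgroup.subset_normalClosure ⟨⟨m, hm⟩, rfl⟩, hρ' _⟩
    | zero => exact ⟨1, one_mem _, fox_one α⟩
    | add m m' _ _ h h' =>
      obtain ⟨r, hr, rfl⟩ := h
      obtain ⟨r', hr', rfl⟩ := h'
      exact ⟨r * r', mul_mem hr hr', fox_mul_of_mem_ker (hN hr) r'⟩
    | smul x m _ h =>
      obtain ⟨r, hr, rfl⟩ := h
      induction x using add_induction with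
      | of g =>
        obtain ⟨f, rfl⟩ := hα g
        refine ⟨f * r * f⁻¹, Subgroup.normalClosure_normal.conj_mem r hr f, ?_⟩
        rw [fox_mul, fox_mul, fox_inv, smul_neg, smul_smul, ← map_mul, map_mul α,
          MonoidHom.mem_ker.1 (hN hr), mul_one, mul_inv_cancel, map_one, one_smul]
        abel
      | add x y h h' =>
        obtain ⟨r, hr, h⟩ := h
        obtain ⟨r', hr', h'⟩ := h'
        exact ⟨r * r', mul_mem hr hr', by rw [fox_mul_of_mem_ker (hN hr), h, h', add_smul]⟩
      | neg x h =>
        obtain ⟨r, hr, h⟩ := h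
        refine ⟨r⁻¹, inv_mem hr, ?_⟩
        rw [fox_inv, MonoidHom.mem_ker.1 (hN hr), inv_one, map_one, one_smul, h, neg_smul]
  obtain ⟨r', hr', h⟩ := key (fox α r) <| hB.ge <| by
    rw [LinearMap.mem_ker, boundary_fox, MonoidHom.mem_ker.1 hr, map_one, sub_self]
  have h₁ : r'⁻¹ * r ∈ ⁅α.ker, α.ker⁆ := by
    refine mem_commutator_of_fox_eq_zero hα (mul_mem (inv_mem (hN hr')) hr) ?_
    have := fox_mul_of_mem_ker (hN hr') (r'⁻¹ * r)
    rw [mul_inv_cancel_left, h] at this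
    simpa using this
  rw [← mul_inv_cancel_left r' r]
  exact Subgroup.mul_mem_sup hr' h₁

end Relations

/-- If the augmentation ideal is finitely generated, then so is the group. -/
theorem fg_of_fg_ker_aug (h : (LinearMap.ker (aug E)).FG) : Group.FG E := by
  have hspan : Submodule.span (MonoidAlgebra ℤ E)
      (Set.range fun g : E => MonoidAlgebra.of ℤ E g - 1) = LinearMap.ker (aug E) := by
    have hsurj : Function.Surjective (FreeGroup.lift (id : E → E)) := fun g =>
      ⟨FreeGroup.of g, FreeGroup.lift_apply_of⟩
    rw [← range_boundary hsurj, boundary, Finsupp.range_linearCombination]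
    simp
  rw [← hspan, Submodule.fg_span_iff_fg_span_finset_subset] at h
  obtain ⟨B, hB, h⟩ := h
  choose! τ hτ using fun m (hm : m ∈ (B : Set (MonoidAlgebra ℤ E))) => hB hm
  refine Group.fg_iff.2 ⟨τ '' B, ?_, B.finite_toSet.image τ⟩
  set H := Subgroup.closure (τ '' B)
  -- The permutation module on `E ⧸ H`: the elements of `B` kill the base point.
  let ρ := Representation.ofMulAction ℤ E (E ⧸ H)
  let δ : ρ.asModule := ρ.asModuleEquiv.symm (MonoidAlgebra.single ((1 : E) : E ⧸ H) 1)
  have hδ (g : E) : (MonoidAlgebra.of ℤ E g - 1) • δ =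
      ρ.asModuleEquiv.symm (MonoidAlgebra.single (g : E ⧸ H) 1 -
        MonoidAlgebra.single ((1 : E) : E ⧸ H) 1) := by
    rw [sub_smul, one_smul, map_sub, ← Representation.asModuleEquiv_symm_map_rho,
      Representation.ofMulAction_single]
    simp [δ]
  have hker (x) (hx : x ∈ Submodule.span (MonoidAlgebra ℤ E) (B : Set (MonoidAlgebra ℤ E))) :
      x • δ = 0 := by
    have hle : Submodule.span (MonoidAlgebra ℤ E) (B : Set (MonoidAlgebra ℤ E)) ≤
        LinearMap.ker (LinearMap.toSpanSingleton (MonoidAlgebra ℤ E) _ δ) := by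
      rw [Submodule.span_le]
      intro m hm
      have hmem : τ m ∈ H := Subgroup.subset_closure ⟨m, hm, rfl⟩
      change m • δ = 0
      rw [← hτ m hm, hδ, show ((τ m : E) : E ⧸ H) = (1 : E) from
        QuotientGroup.eq.2 (by simpa using hmem), sub_self, map_zero]
    exact hle hx
  rw [eq_top_iff]
  intro g _
  have hg := hker _ (h.le (Submodule.subset_span ⟨g, rfl⟩))
  rw [hδ, LinearEquiv.map_eq_zero_iff, sub_eq_zero,
    MonoidAlgebra.single_left_inj one_ne_zero] at hg
  have := QuotientGroup.eq.1 hg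
  simpa using this

theorem finitePresentation_ker_aug {E : Type u} [Group E] (hE : IsTypeFP 2 E) :
    Module.FinitePresentation (MonoidAlgebra ℤ E) (LinearMap.ker (aug E)) := by
  obtain ⟨P, _, _, ε, δ, hproj, hfin, hε, h₀, h₁⟩ := hE
  have := hproj 0
  have := hproj 1
  have := hfin 0 (by norm_num)
  have := hfin 1 (by norm_num)
  have := hfin 2 le_rfl
  exact Module.finitePresentation_ker_of_exact (δ 1) (δ 0) ε hε h₀ (h₁ 0) (aug E) aug_surjective

end GroupRing

/-! ### Covers of the Grigorchuk group -/

namespace GrigCover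

open GrigGen

theorem finiteIndex_stabilizer {E : Type*} [Group E] (ψ : E →* Equiv.Perm (List Bool))
    (hψ : ∀ g w, (ψ g w).length = w.length) (v : List Bool) :
    ((MulAction.stabilizer (Equiv.Perm (List Bool)) v).comap ψ).FiniteIndex := by
  let _ : MulAction E (List Bool) := MulAction.compHom _ ψ
  change (MulAction.stabilizer E v).FiniteIndex
  have hfin : (MulAction.orbit E v).Finite := by
    refine (List.finite_length_eq Bool v.length).subset ?_
    rintro _ ⟨g, rfl⟩
    exact hψ g v
  refine ⟨?_⟩
  rw [MulAction.index_stabilizer]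
  exact (Set.ncard_pos hfin).2 (MulAction.nonempty_orbit v) |>.ne'

/-- Taking sections at a fixed vertex is a homomorphism on the elements which stabilize it. -/
def sectHom {F : Type*} [Group F] (β : F →* GrigCover) (v : List Bool) :
    (MulAction.stabilizer (Equiv.Perm (List Bool)) v).comap (toPerm.comp β) →* GrigCover where
  toFun f := sect (β f) v
  map_one' := by simp
  map_mul' f f' := by
    have h : toPerm (β f') v = v := f'.2
    simp [sect_mul, h]

/-- Let `N` be a group of elements which act trivially on the tree, and which is generated modulo
its commutator subgroup by the conjugates of finitely many elements. Then all sections of `N` at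
the vertices of some level are trivial. Those of the finitely many elements are, by contraction; so
the sections of `N` at one of these vertices form a perfect subgroup of `GrigCover`, which has to be
trivial. -/
theorem exists_forall_sect_eq_one_of_le {F : Type*} [Group F] (β : F →* GrigCover)
    {N : Subgroup F} (hN : N ≤ (toPerm.comp β).ker) {R : Set F} (hR : R.Finite) (hRN : R ⊆ N)
    (h : N ≤ Subgroup.normalClosure R ⊔ ⁅N, N⁆) :
    ∃ n : ℕ, ∀ v : List Bool, v.length = n → ∀ r ∈ N, sect (β r) v = 1 := by
  have hrel (r) (hr : r ∈ R) : ∃ n, ∀ v : List Bool, n ≤ v.length → sect (β r) v = 1 :=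
    exists_forall_sect_eq_one (hN (hRN hr))
  choose! ν hν using hrel
  obtain ⟨n, hn⟩ := (hR.image ν).bddAbove
  refine ⟨n, fun v hv r hr => ?_⟩
  -- The elements which act trivially on the tree and all of whose sections at the level of `v` are
  -- trivial form a normal subgroup. (The section at `v` alone would not give a normal subgroup.)
  let L : Subgroup F :=
    { carrier := {f | f ∈ (toPerm.comp β).ker ∧ ∀ w : List Bool, w.length = n → sect (β f) w = 1}
      one_mem' := ⟨one_mem _, by simp⟩
      mul_mem' := fun {f f'} hf hf' => ⟨mul_mem hf.1 hf'.1, fun w hw => by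
        have : toPerm (β f') w = w := by rw [show toPerm (β f') = 1 from hf'.1]; rfl
        rw [map_mul, sect_mul, this, hf.2 w hw, hf'.2 w hw, one_mul]⟩
      inv_mem' := fun {f} hf => ⟨inv_mem hf.1, fun w hw => by
        have hf' : toPerm (β f) w = w := by rw [show toPerm (β f) = 1 from hf.1]; rfl
        have := sect_mul (β f)⁻¹ (β f) w
        rw [inv_mul_cancel, sect_one, hf', hf.2 w hw, mul_one] at this
        rw [map_inv, ← this]⟩ }
  have hL : L.Normal := ⟨fun f hf g => ⟨(MonoidHom.normal_ker _).conj_mem f hf.1 g, fun w hw => by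
    have hf' (w) : toPerm (β f) w = w := by rw [show toPerm (β f) = 1 from hf.1]; rfl
    rw [map_mul, map_mul, sect_mul, sect_mul, hf', hf.2 _ (by rw [length_toPerm, hw]), mul_one,
      ← sect_mul, ← map_mul, mul_inv_cancel, map_one, sect_one]⟩⟩
  have hRL : Subgroup.normalClosure R ≤ L := by
    refine Subgroup.normalClosure_le_normal fun r hr => ⟨hN (hRN hr), fun w hw => ?_⟩
    refine hν r hr w ?_
    rw [hw]
    exact hn ⟨r, hr, rfl⟩
  -- The homomorphism from `N` which takes the section at `v`.
  have hst : N ≤ (MulAction.stabilizer (Equiv.Perm (List Bool)) v).comap (toPerm.comp β) := by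
    intro f hf
    change toPerm (β f) v = v
    rw [show toPerm (β f) = 1 from hN hf]
    rfl
  let σ : N →* GrigCover := (sectHom β v).comp (Subgroup.inclusion hst)
  have hσ : σ.range = ⊥ := by
    refine eq_bot_of_le_commutator ?_
    rintro _ ⟨x, rfl⟩
    obtain ⟨y, hy, z, hz, hyz⟩ := Subgroup.mem_sup_of_normal_left.1 (h x.2)
    have hzN : z ∈ N := Subgroup.commutator_le_self N hz
    have hyN : y ∈ N := by
      rw [← mul_mem_cancel_right hzN, hyz]
      exact x.2
    obtain rfl : x = ⟨y, hyN⟩ * ⟨z, hzN⟩ := Subtype.ext hyz.symm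
    have hy1 : σ ⟨y, hyN⟩ = 1 := (hRL hy).2 v hv
    rw [map_mul, hy1, one_mul, MonoidHom.range_eq_map, ← Subgroup.map_commutator]
    refine Subgroup.mem_map_of_mem σ ?_
    rw [← Subgroup.map_subtype_commutator] at hz
    obtain ⟨z', hz', rfl⟩ := hz
    exact hz'
  have : σ ⟨r, hr⟩ ∈ σ.range := ⟨_, rfl⟩
  rw [hσ] at this
  exact this

/-- If the section at `v` is trivial on the kernel of `α`, then the stabilizer of `v` in the target
of `α` maps onto `GrigCover`. -/
theorem exists_surjective_stabilizer {F E : Type*} [Group F] [Group E] {α : F →* E}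
    (hα : Function.Surjective α) {β : F →* GrigCover} (hβ : Function.Surjective β)
    {ψ : E →* Equiv.Perm (List Bool)} (hψ : ψ.comp α = toPerm.comp β) {n : ℕ}
    (h : ∀ r ∈ α.ker, sect (β r) (List.replicate n true) = 1) :
    ∃ f : (MulAction.stabilizer (Equiv.Perm (List Bool)) (List.replicate n true)).comap ψ →*
      GrigCover, Function.Surjective f := by
  set v := List.replicate n true
  let K := (MulAction.stabilizer (Equiv.Perm (List Bool)) v).comap ψ
  have hK : (MulAction.stabilizer (Equiv.Perm (List Bool)) v).comap (toPerm.comp β) =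
      K.comap α := by
    rw [← hψ, Subgroup.comap_comap]
  let σ : K.comap α →* GrigCover :=
    (sectHom β v).comp (Subgroup.inclusion hK.ge)
  have hα' : Function.Surjective (α.subgroupComap K) := by
    rintro ⟨e, he⟩
    obtain ⟨f, rfl⟩ := hα e
    exact ⟨⟨f, he⟩, rfl⟩
  have hker : (α.subgroupComap K).ker ≤ σ.ker := by
    rintro ⟨f, hf⟩ hf'
    exact h f (congrArg Subtype.val hf')
  refine ⟨(α.subgroupComap K).liftOfSurjective hα' ⟨σ, hker⟩, fun g => ?_⟩
  obtain ⟨k, hk, hkg⟩ := exists_sect_replicate_eq n g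
  obtain ⟨f, rfl⟩ := hβ k
  have hf : f ∈ K.comap α := hK.le hk
  refine ⟨α.subgroupComap K ⟨f, hf⟩, ?_⟩
  exact (MonoidHom.liftOfRightInverse_comp_apply ..).trans hkg

end GrigCover

theorem proposition4p12 (E : Type u) [Group E] (hE : IsTypeFP 2 E)
    (π : E →* GrigorchukGroup) (hπ : Function.Surjective π) : IsLargeGroup E := by
  have hfp := GroupRing.finitePresentation_ker_aug hE
  obtain ⟨T, hT, hTfin⟩ := Group.fg_iff.1
    (GroupRing.fg_of_fg_ker_aug (E := E) (Module.Finite.iff_fg.1 inferInstance))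
  have : Finite T := hTfin
  have : Finite GrigGen := by
    refine Finite.of_injective (β := Bool × Bool) (fun
      | .a => (true, true)
      | .b => (true, false)
      | .c => (false, true)
      | .d => (false, false)) ?_
    rintro (_ | _ | _ | _) (_ | _ | _ | _) <;> simp
  let ψ : E →* Equiv.Perm (List Bool) := GrigorchukGroup.subtype.comp π
  have hrange (e : E) : ∃ g, GrigCover.toPerm g = ψ e :=
    GrigCover.range_toPerm.ge (π e).2
  have hgen (s : GrigGen) : ∃ e, ψ e = grigPerm s := by
    obtain ⟨e, he⟩ := hπ ⟨grigPerm s, Subgroup.subset_closure ⟨s, rfl⟩⟩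
    exact ⟨e, congrArg Subtype.val he⟩
  choose γ hγ using hrange
  choose e he using hgen
  -- Generators of `E` together with preimages of `a`, `b`, `c`, `d`, so that `β` is onto.
  let α : FreeGroup (T ⊕ GrigGen) →* E := FreeGroup.lift (Sum.elim Subtype.val e)
  let β : FreeGroup (T ⊕ GrigGen) →* GrigCover :=
    FreeGroup.lift (Sum.elim (fun t => γ t) GrigCover.gen)
  have hα : Function.Surjective α := by
    rw [← MonoidHom.range_eq_top, eq_top_iff, ← hT, Subgroup.closure_le]
    intro t ht
    exact ⟨FreeGroup.of (Sum.inl ⟨t, ht⟩), by simp [α]⟩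
  have hβ : Function.Surjective β := by
    rw [← MonoidHom.range_eq_top, eq_top_iff, ← GrigCover.closure_gen, Subgroup.closure_le]
    rintro _ ⟨s, rfl⟩
    exact ⟨FreeGroup.of (Sum.inr s), by simp [β]⟩
  have hψ : ψ.comp α = GrigCover.toPerm.comp β := by
    ext1 (t | s)
    · simp [α, β, hγ]
    · simp only [MonoidHom.comp_apply, α, β, FreeGroup.lift_apply_of, Sum.elim_inr, he]
      exact (GrigCover.lift_gen ..).symm
  obtain ⟨R, hR, hRα, hle⟩ := GroupRing.exists_finite_ker_le hα hfp
  have hker : α.ker ≤ (GrigCover.toPerm.comp β).ker := by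
    rw [← hψ]
    exact fun r hr => by simp [MonoidHom.mem_ker.1 hr]
  obtain ⟨n, hn⟩ := GrigCover.exists_forall_sect_eq_one_of_le β hker hR hRα hle
  obtain ⟨f, hf⟩ := GrigCover.exists_surjective_stabilizer hα hβ hψ
    (hn (List.replicate n true) (List.length_replicate ..))
  refine GrigCover.isLargeGroup.of_surjective (GrigCover.finiteIndex_stabilizer ψ ?_ _) f hf
  intro g w
  rw [← hγ g, GrigCover.length_toPerm]
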